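/- Let $n\in\mathbb{N}$, $q\in\mathbb{R}$, and let $U\in\mathcal{U}(2n)$ be a unitary operator of $\mathbb{C}^n\oplus\mathbb{C}^n$. For $f\in W^{2,2}(\mathbb{R}\setminus\{q\},\mathbb{C}^n)$ let $f(q\pm)$, $f'(q\pm)$ denote the one-sided limits at $q$, and put $$\Gamma_1 f=\big(f(q-),f(q+)\big),\qquad \Gamma_2 f=\big(-f'(q-),f'(q+)\big).$$ Let $H_U$ be the operator $f\mapsto -f''$ in $L^2(\mathbb{R},\mathbb{C}^n)$ with domain $$\mathrm{dom}\,H_U=\{f\in W^{2,2}(\mathbb{R}\setminus\{q\},\mathbb{C}^n):\ (\Gamma_1-i\Gamma_2)f=U(\Gamma_1+i\Gamma_2)f\}.$$ For $n=1$ and $V\in\mathcal{U}(2)$ the operators $H_V$ in $L^2(\mathbb{R})$ obtained in this way are called one-dimensional point interaction Hamiltonians at $q$. The operator $H_U$ is called reducible if there exist $\Theta\in\mathcal{U}(n)$ and $V_1,\dots,V_n\in\mathcal{U}(2)$ such that the unitary transformation $f\mapsto\Theta f$, $(\Theta f)(x)=\Theta(f(x))$, of $L^2(\mathbb{R},\mathbb{C}^n)=\bigoplus_{s=1}^n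 L^2(\mathbb{R})$ satisfies $\Theta H_U\Theta^{-1}=\bigoplus_{s=1}^n H_{V_s}$. Suppose there exist $\alpha,\beta\in\mathbb{R}$ with $|\alpha|+|\beta|>0$ and $c,c'\in\{-1,1\}$ such that $$\alpha\big(f'(q+)+c'f'(q-)\big)=\beta\big(f(q+)+c f(q-)\big)\qquad\text{for all } f\in\mathrm{dom}\,H_U.$$ Then $H_U$ is reducible. -/

import Mathlib

open MeasureTheory Filter Topology
open scoped ContDiff ENNReal

noncomputable section

namespace CoupledChannels

/-- The Hilbert space `L²(ℝ, E)`; `E = ℂⁿ` for `n` channels, `E = ℂ` for a single channel. -/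
abbrev L2 (E : Type*) [NormedAddCommGroup E] : Type _ := Lp E 2 (volume : Measure ℝ)

variable {E : Type*} [NormedAddCommGroup E] [InnerProductSpace ℂ E]

/-- `g` is the weak derivative of `f` on `ℝ ∖ {q}`, tested against `C_c^∞(ℝ ∖ {q})`. Thus
`f ∈ W^{1,2}(ℝ ∖ {q}, E)` iff `∃ g, IsWeakDeriv q f g`. -/
def IsWeakDeriv (q : ℝ) (f g : L2 E) : Prop :=
  ∀ φ : ℝ → ℝ, ContDiff ℝ ∞ φ → HasCompactSupport φ → tsupport φ ⊆ {q}ᶜ →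
    ∫ x, deriv φ x • f x = - ∫ x, φ x • g x

/-- `f(q-) = a` and `f(q+) = b`. The one-sided limits are taken along `ae volume`, so that they
depend only on the class of `f`; for the continuous representative of a function in
`W^{1,2}(ℝ ∖ {q}, E)` they are the ordinary one-sided limits, and they exist for every such function. -/
def HasOneSidedLimits (q : ℝ) (f : L2 E) (a b : E) : Prop :=
  Tendsto f (𝓝[<] q ⊓ ae volume) (𝓝 a) ∧ Tendsto f (𝓝[>] q ⊓ ae volume) (𝓝 b)

/-- `f(q-) = a`, `f(q+) = b`, `f'(q-) = a'`, `f'(q+) = b'`. -/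
def HasBoundaryValues (q : ℝ) (f : L2 E) (a b a' b' : E) : Prop :=
  HasOneSidedLimits q f a b ∧ ∃ f' : L2 E, IsWeakDeriv q f f' ∧ HasOneSidedLimits q f' a' b'

/-- `Γ₁ f = (f(q-), f(q+))` in `E ⊕ E`. -/
def Gamma1 (a b : E) : WithLp 2 (E × E) := WithLp.toLp 2 (a, b)

/-- `Γ₂ f = (-f'(q-), f'(q+))` in `E ⊕ E`. -/
def Gamma2 (a' b' : E) : WithLp 2 (E × E) := WithLp.toLp 2 (-a', b')

/-- The boundary condition `(Γ₁ - iΓ₂) f = U (Γ₁ + iΓ₂) f`,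
with `U` a unitary operator of `E ⊕ E`. -/
def BoundaryCondition (U : WithLp 2 (E × E) ≃ₗᵢ[ℂ] WithLp 2 (E × E)) (a b a' b' : E) : Prop :=
  Gamma1 a b - Complex.I • Gamma2 a' b' = U (Gamma1 a b + Complex.I • Gamma2 a' b')

lemma integrable_smul (f : L2 E) {φ : ℝ → ℝ} (hφ : Continuous φ) (hc : HasCompactSupport φ) :
    Integrable (fun x => φ x • f x) := by
  have h : LocallyIntegrable (f : ℝ → E) volume :=
    (Lp.memLp f).locallyIntegrable (by norm_num)
  exact h.integrable_smul_left_of_hasCompactSupport hφ hc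

lemma IsWeakDeriv.zero (q : ℝ) : IsWeakDeriv q (0 : L2 E) 0 := by
  intro φ _ _ _
  have h : ∀ ψ : ℝ → ℝ, ∫ x, ψ x • (0 : L2 E) x = 0 := fun ψ => by
    refine integral_eq_zero_of_ae ?_
    filter_upwards [Lp.coeFn_zero E 2 (volume : Measure ℝ)] with x hx
    rw [hx, Pi.zero_apply, smul_zero]
  rw [h, h, neg_zero]

lemma IsWeakDeriv.add {q : ℝ} {f g f₁ g₁ : L2 E} (h : IsWeakDeriv q f g)
    (h₁ : IsWeakDeriv q f₁ g₁) : IsWeakDeriv q (f + f₁) (g + g₁) := by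
  intro φ hφ hc hs
  have key : ∀ ψ : ℝ → ℝ, Continuous ψ → HasCompactSupport ψ → ∀ u v : L2 E,
      ∫ x, ψ x • (u + v : L2 E) x = (∫ x, ψ x • u x) + ∫ x, ψ x • v x := by
    intro ψ hψ hψc u v
    rw [← integral_add (integrable_smul u hψ hψc) (integrable_smul v hψ hψc)]
    refine integral_congr_ae ?_
    filter_upwards [Lp.coeFn_add u v] with x hx
    rw [hx, Pi.add_apply, smul_add]
  rw [key _ (hφ.continuous_deriv (by simp)) hc.deriv, key _ hφ.continuous hc,
    h φ hφ hc hs, h₁ φ hφ hc hs]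
  abel

lemma IsWeakDeriv.smul {q : ℝ} {f g : L2 E} (z : ℂ) (h : IsWeakDeriv q f g) :
    IsWeakDeriv q (z • f) (z • g) := by
  intro φ hφ hc hs
  have key : ∀ ψ : ℝ → ℝ, ∀ u : L2 E,
      ∫ x, ψ x • (z • u : L2 E) x = z • ∫ x, ψ x • u x := by
    intro ψ u
    rw [← integral_smul]
    refine integral_congr_ae ?_
    filter_upwards [Lp.coeFn_smul z u] with x hx
    rw [hx, Pi.smul_apply, smul_comm]
  rw [key, key, h φ hφ hc hs, smul_neg]

lemma IsWeakDeriv.eq_zero [CompleteSpace E] {q : ℝ} {g : L2 E} (h : IsWeakDeriv q 0 g) :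
    g = 0 := by
  have h0 : ∀ᵐ x ∂(volume : Measure ℝ), x ∈ ({q}ᶜ : Set ℝ) → g x = 0 := by
    refine isOpen_compl_singleton.ae_eq_zero_of_integral_contDiff_smul_eq_zero
      (((Lp.memLp g).locallyIntegrable (by norm_num)).locallyIntegrableOn _) ?_
    intro φ hφ hc hs
    have h1 := h φ hφ hc hs
    have h2 : ∫ x, deriv φ x • (0 : L2 E) x = 0 := by
      refine integral_eq_zero_of_ae ?_
      filter_upwards [Lp.coeFn_zero E 2 (volume : Measure ℝ)] with x hx
      rw [hx, Pi.zero_apply, smul_zero]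
    rw [h2] at h1
    exact neg_eq_zero.mp h1.symm
  rw [Lp.eq_zero_iff_ae_eq_zero]
  filter_upwards [h0, Measure.ae_ne volume q] with x hx hq
  exact hx hq

lemma HasOneSidedLimits.zero (q : ℝ) : HasOneSidedLimits q (0 : L2 E) 0 0 := by
  have h : ∀ l : Filter ℝ, Tendsto ((0 : L2 E) : ℝ → E) (l ⊓ ae volume) (𝓝 0) := fun l =>
    tendsto_const_nhds.congr'
      ((Lp.coeFn_zero E 2 (volume : Measure ℝ)).symm.filter_mono inf_le_right)
  exact ⟨h _, h _⟩

lemma HasOneSidedLimits.add {q : ℝ} {f f₁ : L2 E} {a b a₁ b₁ : E}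
    (h : HasOneSidedLimits q f a b) (h₁ : HasOneSidedLimits q f₁ a₁ b₁) :
    HasOneSidedLimits q (f + f₁) (a + a₁) (b + b₁) :=
  ⟨(h.1.add h₁.1).congr' ((Lp.coeFn_add f f₁).symm.filter_mono inf_le_right),
    (h.2.add h₁.2).congr' ((Lp.coeFn_add f f₁).symm.filter_mono inf_le_right)⟩

lemma HasOneSidedLimits.smul {q : ℝ} {f : L2 E} {a b : E} (z : ℂ)
    (h : HasOneSidedLimits q f a b) : HasOneSidedLimits q (z • f) (z • a) (z • b) :=
  ⟨(h.1.const_smul z).congr' ((Lp.coeFn_smul z f).symm.filter_mono inf_le_right),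
    (h.2.const_smul z).congr' ((Lp.coeFn_smul z f).symm.filter_mono inf_le_right)⟩

lemma BoundaryCondition.zero (U : WithLp 2 (E × E) ≃ₗᵢ[ℂ] WithLp 2 (E × E)) :
    BoundaryCondition U 0 0 0 0 := by
  have h1 : Gamma1 (0 : E) 0 = 0 := rfl
  have h2 : Gamma2 (0 : E) 0 = 0 := by simp [Gamma2]
  simp [BoundaryCondition, h1, h2]

lemma BoundaryCondition.add {U : WithLp 2 (E × E) ≃ₗᵢ[ℂ] WithLp 2 (E × E)}
    {a b a' b' a₁ b₁ a₁' b₁' : E} (h : BoundaryCondition U a b a' b')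
    (h₁ : BoundaryCondition U a₁ b₁ a₁' b₁') :
    BoundaryCondition U (a + a₁) (b + b₁) (a' + a₁') (b' + b₁') := by
  unfold BoundaryCondition at *
  have e1 : Gamma1 (a + a₁) (b + b₁) = Gamma1 a b + Gamma1 a₁ b₁ := rfl
  have e2 : Gamma2 (a' + a₁') (b' + b₁') = Gamma2 a' b' + Gamma2 a₁' b₁' := by
    simp only [Gamma2, ← WithLp.toLp_add, Prod.mk_add_mk, neg_add]
  have e3 : Gamma1 a b + Gamma1 a₁ b₁ + Complex.I • (Gamma2 a' b' + Gamma2 a₁' b₁') =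
      (Gamma1 a b + Complex.I • Gamma2 a' b') +
        (Gamma1 a₁ b₁ + Complex.I • Gamma2 a₁' b₁') := by
    rw [smul_add]; abel
  rw [e1, e2, e3, map_add, ← h, ← h₁, smul_add]
  abel

lemma BoundaryCondition.smul {U : WithLp 2 (E × E) ≃ₗᵢ[ℂ] WithLp 2 (E × E)}
    {a b a' b' : E} (z : ℂ) (h : BoundaryCondition U a b a' b') :
    BoundaryCondition U (z • a) (z • b) (z • a') (z • b') := by
  unfold BoundaryCondition at *
  have e1 : Gamma1 (z • a) (z • b) = z • Gamma1 a b := rfl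
  have e2 : Gamma2 (z • a') (z • b') = z • Gamma2 a' b' := by
    simp only [Gamma2, ← WithLp.toLp_smul, Prod.smul_mk, smul_neg]
  rw [e1, e2, smul_comm Complex.I z, ← smul_sub, ← smul_add, map_smul, h]

/-- The graph of `H_U`: pairs `(f, -f'')` where `f, f', f'' ∈ L²(ℝ, E)`, i.e.
`f ∈ W^{2,2}(ℝ ∖ {q}, E)`, and the boundary values of `f` at `q` satisfy the boundary condition. -/
def hamiltonianGraph (q : ℝ) (U : WithLp 2 (E × E) ≃ₗᵢ[ℂ] WithLp 2 (E × E)) :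
    Submodule ℂ (L2 E × L2 E) where
  carrier := {p | ∃ f' f'' : L2 E, IsWeakDeriv q p.1 f' ∧ IsWeakDeriv q f' f'' ∧ p.2 = -f'' ∧
    ∃ a b a' b' : E, HasOneSidedLimits q p.1 a b ∧ HasOneSidedLimits q f' a' b' ∧
      BoundaryCondition U a b a' b'}
  add_mem' := by
    rintro ⟨f, h⟩ ⟨g, k⟩ ⟨f', f'', h1, h2, h3, a, b, a', b', h4, h5, h6⟩
      ⟨g', g'', k1, k2, k3, c, d, c', d', k4, k5, k6⟩
    refine ⟨f' + g', f'' + g'', h1.add k1, h2.add k2, ?_, a + c, b + d, a' + c', b' + d',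
      h4.add k4, h5.add k5, h6.add k6⟩
    change h = _ at h3
    change k = _ at k3
    change h + k = _
    rw [h3, k3, neg_add]
  zero_mem' := ⟨0, 0, IsWeakDeriv.zero q, IsWeakDeriv.zero q, by simp, 0, 0, 0, 0,
    HasOneSidedLimits.zero q, HasOneSidedLimits.zero q, BoundaryCondition.zero U⟩
  smul_mem' := by
    rintro z ⟨f, h⟩ ⟨f', f'', h1, h2, h3, a, b, a', b', h4, h5, h6⟩
    refine ⟨z • f', z • f'', h1.smul z, h2.smul z, ?_, z • a, z • b, z • a', z • b',
      h4.smul z, h5.smul z, h6.smul z⟩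
    change h = _ at h3
    change z • h = _
    rw [h3, smul_neg]

/-- The point interaction Hamiltonian `H_U` in `L²(ℝ, E)`, with interaction at the point `q`:
the unbounded operator `f ↦ -f''` with the graph `hamiltonianGraph q U`
(see `hamiltonian_graph`). -/
def hamiltonian (q : ℝ) (U : WithLp 2 (E × E) ≃ₗᵢ[ℂ] WithLp 2 (E × E)) : L2 E →ₗ.[ℂ] L2 E :=
  (hamiltonianGraph q U).toLinearPMap

lemma hamiltonian_graph [CompleteSpace E] (q : ℝ)
    (U : WithLp 2 (E × E) ≃ₗᵢ[ℂ] WithLp 2 (E × E)) :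
    (hamiltonian q U).graph = hamiltonianGraph q U := by
  refine Submodule.toLinearPMap_graph_eq _ ?_
  rintro ⟨f, h⟩ ⟨f', f'', h1, h2, h3, -⟩ hf
  change f = 0 at hf
  subst hf
  have e := h1.eq_zero
  subst e
  change h = _ at h3
  change h = 0
  rw [h3, h2.eq_zero, neg_zero]

/-- The `s`-th component `f_s ∈ L²(ℝ)` of `f ∈ L²(ℝ, ℂⁿ)`. -/
def component {n : ℕ} (s : Fin n) (f : L2 (EuclideanSpace ℂ (Fin n))) : L2 ℂ :=
  (EuclideanSpace.proj s : EuclideanSpace ℂ (Fin n) →L[ℂ] ℂ).compLpL 2 volume f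

lemma component_ext {n : ℕ} {f : L2 (EuclideanSpace ℂ (Fin n))}
    (h : ∀ s, component s f = 0) : f = 0 := by
  rw [Lp.eq_zero_iff_ae_eq_zero]
  have h' : ∀ s, ∀ᵐ x ∂(volume : Measure ℝ), f x s = 0 := by
    intro s
    have h1 := (Lp.eq_zero_iff_ae_eq_zero).1 (h s)
    have h2 := ContinuousLinearMap.coeFn_compLpL (p := 2) (μ := (volume : Measure ℝ))
      (EuclideanSpace.proj s : EuclideanSpace ℂ (Fin n) →L[ℂ] ℂ) f
    filter_upwards [h1, h2] with x hx hx2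
    have : component s f x = f x s := hx2
    rw [← this, hx]
    rfl
  filter_upwards [ae_all_iff.2 h'] with x hx
  ext s
  exact hx s

/-- The graph of the direct sum of operators `T s` in `L²(ℝ)`, as an operator in
`⊕ₛ L²(ℝ) = L²(ℝ, ℂⁿ)`. -/
def directSumGraph {n : ℕ} (T : Fin n → (L2 ℂ →ₗ.[ℂ] L2 ℂ)) :
    Submodule ℂ (L2 (EuclideanSpace ℂ (Fin n)) × L2 (EuclideanSpace ℂ (Fin n))) where
  carrier := {p | ∀ s, (component s p.1, component s p.2) ∈ (T s).graph}
  add_mem' := by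
    intro p r hp hr s
    have := (T s).graph.add_mem (hp s) (hr s)
    simpa [component] using this
  zero_mem' := by
    intro s
    simp [component]
  smul_mem' := by
    intro z p hp s
    have := (T s).graph.smul_mem z (hp s)
    simpa [component] using this

/-- The direct sum `⊕ₛ T s`: its domain consists of the `f` with `f_s ∈ dom (T s)` for all `s`,
and its action is `((⊕ T) f)_s = T s f_s` (see `directSum_graph`). -/
def directSum {n : ℕ} (T : Fin n → (L2 ℂ →ₗ.[ℂ] L2 ℂ)) :
    L2 (EuclideanSpace ℂ (Fin n)) →ₗ.[ℂ] L2 (EuclideanSpace ℂ (Fin n)) :=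
  (directSumGraph T).toLinearPMap

lemma directSum_graph {n : ℕ} (T : Fin n → (L2 ℂ →ₗ.[ℂ] L2 ℂ)) :
    (directSum T).graph = directSumGraph T := by
  refine Submodule.toLinearPMap_graph_eq _ ?_
  rintro ⟨f, h⟩ hp hf
  change f = 0 at hf
  subst hf
  refine component_ext fun s => ?_
  exact (T s).graph_fst_eq_zero_snd (hp s) (by simp [component])

/-- The transformation `(Θ f)(x) = Θ (f(x))` of `L²(ℝ, ℂⁿ)` induced by `Θ ∈ U(n)`. -/
def pointwise {n : ℕ} (Θ : EuclideanSpace ℂ (Fin n) ≃ₗᵢ[ℂ] EuclideanSpace ℂ (Fin n))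
    (f : L2 (EuclideanSpace ℂ (Fin n))) : L2 (EuclideanSpace ℂ (Fin n)) :=
  (Θ.toContinuousLinearEquiv : EuclideanSpace ℂ (Fin n) →L[ℂ] EuclideanSpace ℂ (Fin n)).compLpL
    2 volume f

/-- An operator `H` in `L²(ℝ, ℂⁿ)` is reducible (for point interactions at `q`) if for some
`Θ ∈ U(n)` the operator `Θ H Θ⁻¹` is a direct sum of `n` one-dimensional point interaction
Hamiltonians at `q`. Since `f ↦ Θ f` is a bijection, the equality `Θ H Θ⁻¹ = ⊕ₛ H_s` says that
`(f, h)` is in the graph of `H` iff `(Θ f, Θ h)` is in the graph of the direct sum. -/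
def IsReducible {n : ℕ} (q : ℝ)
    (H : L2 (EuclideanSpace ℂ (Fin n)) →ₗ.[ℂ] L2 (EuclideanSpace ℂ (Fin n))) : Prop :=
  ∃ (Θ : EuclideanSpace ℂ (Fin n) ≃ₗᵢ[ℂ] EuclideanSpace ℂ (Fin n))
    (V : Fin n → (WithLp 2 (ℂ × ℂ) ≃ₗᵢ[ℂ] WithLp 2 (ℂ × ℂ))),
    ∀ f h : L2 (EuclideanSpace ℂ (Fin n)),
      (f, h) ∈ H.graph ↔
        (pointwise Θ f, pointwise Θ h) ∈ (directSum fun s => hamiltonian q (V s)).graph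

end CoupledChannels

end

/-! Put `w = (Γ₁ + iΓ₂) f`. On `dom H_U` the boundary condition reads `U w = (Γ₁ - iΓ₂) f`, so `Γ₁ f
= (w + U w) / 2` and `Γ₂ f = (w - U w) / (2i)`. Every `w` in `ℂⁿ ⊕ ℂⁿ` occurs, because boundary
values of `W^{2,2}(ℝ ∖ {q})` functions are arbitrary (`exists_boundary_values`). The assumed
relation therefore becomes an identity `r (U w) = r' w` for all `w`, where `r` and `r'` are rows of
two scalars, each acting on `ℂⁿ` as a multiple of the identity (`boundary_relation`).

Since `α` and `β` are real and `c² = c'² = 1`, both rows have squared norm `2(α² + β²)`. After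
normalization they complete to unitary 2×2 matrices, with which `U` turns into a unitary that
preserves the first component, hence into `1 ⊕ W` with `W` an isometry of `ℂⁿ`
(`exists_isometry_of_fst_eq`).

An orthonormal eigenbasis of `W` supplies `Θ`. The 2×2 matrices do not mix channels, so `U` splits
in this basis into unitaries of `ℂ ⊕ ℂ` (`isReducible_of_rotation`), and a splitting of `U` gives
one of the operator (`isReducible_of_channelPair`). -/

noncomputable section

namespace CoupledChannels

/-! ### Isometries in finite dimension and unitaries of `E ⊕ E` -/

section LinearAlgebra

variable {E : Type*} [NormedAddCommGroup E] [InnerProductSpace ℂ E]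

/-- A linear isometry of a finite-dimensional complex inner product space is semisimple. -/
lemma isSemisimple_of_isometry [FiniteDimensional ℂ E] (W : E →ₗᵢ[ℂ] E) :
    Module.End.IsSemisimple (W.toLinearMap : Module.End ℂ E) := by
  rw [Module.End.isSemisimple_iff]
  intro p hp
  refine ⟨pᗮ, ?_, p.isCompl_orthogonal⟩
  -- By injectivity and dimension an invariant `p` is mapped onto itself. Each `u` in `p` is then
  -- some `W v` with `v` in `p`, and `⟪W v, W x⟫ = ⟪v, x⟫ = 0` for `x` in `pᗮ`.
  have hmap : p.map W.toLinearMap = p := by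
    refine Submodule.eq_of_le_of_finrank_eq (Submodule.map_le_iff_le_comap.2 hp) ?_
    exact (Submodule.equivMapOfInjective W.toLinearMap W.injective p).finrank_eq.symm
  intro x hx
  rw [Submodule.mem_comap, Submodule.mem_orthogonal]
  intro u hu
  rw [← hmap] at hu
  obtain ⟨v, hv, rfl⟩ := hu
  simpa using (Submodule.mem_orthogonal p x).1 hx v hv

/-- Eigenspaces of a linear isometry for distinct eigenvalues are orthogonal. -/
lemma orthogonalFamily_eigenspaces_of_isometry (W : E →ₗᵢ[ℂ] E) :
    OrthogonalFamily ℂ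
      (fun μ : Module.End.Eigenvalues (W.toLinearMap : Module.End ℂ E) =>
        Module.End.eigenspace (W.toLinearMap : Module.End ℂ E) (μ : ℂ))
      fun μ => (Module.End.eigenspace (W.toLinearMap : Module.End ℂ E) (μ : ℂ)).subtypeₗᵢ := by
  rintro ⟨μ, hμ⟩ ⟨ν, hν⟩ hne ⟨v, hv⟩ ⟨w, hw⟩
  obtain ⟨v₀, hv₀⟩ := Module.End.HasEigenvalue.exists_hasEigenvector hμ
  have hnorm : ‖μ‖ = 1 := by
    have h := W.norm_map v₀
    have h1 : W v₀ = μ • v₀ := hv₀.apply_eq_smul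
    rw [h1, norm_smul] at h
    exact mul_right_cancel₀ (norm_ne_zero_iff.2 hv₀.2) (by rw [h, one_mul])
  have hv' : W v = μ • v := Module.End.mem_eigenspace_iff.1 hv
  have hw' : W w = ν • w := Module.End.mem_eigenspace_iff.1 hw
  have h := W.inner_map_map v w
  rw [hv', hw', inner_smul_left, inner_smul_right] at h
  have hμμ : (starRingEnd ℂ) μ * μ = 1 := by rw [Complex.conj_mul', hnorm]; simp
  -- At this point `conj μ * ν * ⟪v, w⟫ = ⟪v, w⟫`; if the inner product were nonzero, `conj μ * ν =
  -- 1 = conj μ * μ` would force `μ = ν`.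
  change inner ℂ v w = 0
  by_contra h0
  apply hne
  have h1 : (starRingEnd ℂ) μ * ν = 1 :=
    mul_right_cancel₀ h0 (by rw [mul_assoc, h, one_mul])
  have h2 : (starRingEnd ℂ) μ ≠ 0 := left_ne_zero_of_mul_eq_one hμμ
  have : μ = ν := mul_left_cancel₀ h2 (by rw [hμμ, h1])
  subst this
  rfl

/-- The spectral theorem for linear isometries in finite dimension. -/
lemma exists_orthonormalBasis_of_isometry [FiniteDimensional ℂ E] {n : ℕ}
    (hn : Module.finrank ℂ E = n) (W : E →ₗᵢ[ℂ] E) :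
    ∃ (b : OrthonormalBasis (Fin n) ℂ E) (μ : Fin n → ℂ), ∀ s, W (b s) = μ s • b s := by
  classical
  have horth := orthogonalFamily_eigenspaces_of_isometry W
  have htop : (⨆ μ : Module.End.Eigenvalues (W.toLinearMap : Module.End ℂ E),
      Module.End.eigenspace (W.toLinearMap : Module.End ℂ E) (μ : ℂ)) = ⊤ := by
    rw [eq_top_iff, ← (isSemisimple_of_isometry W).iSup_eigenspace_eq_top]
    refine iSup_le fun μ => ?_
    by_cases hμ : Module.End.HasEigenvalue (W.toLinearMap : Module.End ℂ E) μ
    · exact le_iSup (fun μ : Module.End.Eigenvalues (W.toLinearMap : Module.End ℂ E) =>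
        Module.End.eigenspace (W.toLinearMap : Module.End ℂ E) (μ : ℂ)) ⟨μ, hμ⟩
    · rw [Module.End.hasEigenvalue_iff, not_not] at hμ
      rw [hμ]
      exact bot_le
  have hinternal := horth.isInternal_iff.2 (by rw [htop, Submodule.top_orthogonal_eq_bot])
  refine ⟨hinternal.subordinateOrthonormalBasis hn horth,
    fun s => ((hinternal.subordinateOrthonormalBasisIndex hn s horth :
      Module.End.Eigenvalues (W.toLinearMap : Module.End ℂ E)) : ℂ), fun s => ?_⟩
  exact Module.End.mem_eigenspace_iff.1 (hinternal.subordinateOrthonormalBasis_subordinate hn s horth)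

/-- The unitary operator of `E ⊕ E` given by the matrix with columns `(z₁, z₂)` and
`(-conj z₂, conj z₁)`. -/
def rotation (E : Type*) [NormedAddCommGroup E] [InnerProductSpace ℂ E] (z₁ z₂ : ℂ)
    (hz : ‖z₁‖ ^ 2 + ‖z₂‖ ^ 2 = 1) : WithLp 2 (E × E) ≃ₗᵢ[ℂ] WithLp 2 (E × E) where
  toFun w := WithLp.toLp 2 (z₁ • w.fst - (starRingEnd ℂ) z₂ • w.snd,
    z₂ • w.fst + (starRingEnd ℂ) z₁ • w.snd)
  invFun w := WithLp.toLp 2 ((starRingEnd ℂ) z₁ • w.fst + (starRingEnd ℂ) z₂ • w.snd,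
    z₁ • w.snd - z₂ • w.fst)
  map_add' v w := by
    refine (WithLp.ext_iff 2).2 (Prod.ext ?_ ?_)
    · change z₁ • (v.fst + w.fst) - (starRingEnd ℂ) z₂ • (v.snd + w.snd) =
        (z₁ • v.fst - (starRingEnd ℂ) z₂ • v.snd) + (z₁ • w.fst - (starRingEnd ℂ) z₂ • w.snd)
      module
    · change z₂ • (v.fst + w.fst) + (starRingEnd ℂ) z₁ • (v.snd + w.snd) =
        (z₂ • v.fst + (starRingEnd ℂ) z₁ • v.snd) + (z₂ • w.fst + (starRingEnd ℂ) z₁ • w.snd)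
      module
  map_smul' t w := by
    refine (WithLp.ext_iff 2).2 (Prod.ext ?_ ?_)
    · change z₁ • (t • w.fst) - (starRingEnd ℂ) z₂ • (t • w.snd) =
        t • (z₁ • w.fst - (starRingEnd ℂ) z₂ • w.snd)
      module
    · change z₂ • (t • w.fst) + (starRingEnd ℂ) z₁ • (t • w.snd) =
        t • (z₂ • w.fst + (starRingEnd ℂ) z₁ • w.snd)
      module
  left_inv w := by
    have h : (starRingEnd ℂ) z₁ * z₁ + (starRingEnd ℂ) z₂ * z₂ = 1 := by
      rw [Complex.conj_mul', Complex.conj_mul']; exact_mod_cast hz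
    refine (WithLp.ext_iff 2).2 (Prod.ext ?_ ?_)
    · change (starRingEnd ℂ) z₁ • (z₁ • w.fst - (starRingEnd ℂ) z₂ • w.snd) +
        (starRingEnd ℂ) z₂ • (z₂ • w.fst + (starRingEnd ℂ) z₁ • w.snd) = w.fst
      match_scalars <;> first | ring1 | linear_combination h
    · change z₁ • (z₂ • w.fst + (starRingEnd ℂ) z₁ • w.snd) -
        z₂ • (z₁ • w.fst - (starRingEnd ℂ) z₂ • w.snd) = w.snd
      match_scalars <;> first | ring1 | linear_combination h
  right_inv w := by
    have h : (starRingEnd ℂ) z₁ * z₁ + (starRingEnd ℂ) z₂ * z₂ = 1 := by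
      rw [Complex.conj_mul', Complex.conj_mul']; exact_mod_cast hz
    refine (WithLp.ext_iff 2).2 (Prod.ext ?_ ?_)
    · change z₁ • ((starRingEnd ℂ) z₁ • w.fst + (starRingEnd ℂ) z₂ • w.snd) -
        (starRingEnd ℂ) z₂ • (z₁ • w.snd - z₂ • w.fst) = w.fst
      match_scalars <;> first | ring1 | linear_combination h
    · change z₂ • ((starRingEnd ℂ) z₁ • w.fst + (starRingEnd ℂ) z₂ • w.snd) +
        (starRingEnd ℂ) z₁ • (z₁ • w.snd - z₂ • w.fst) = w.snd
      match_scalars <;> first | ring1 | linear_combination h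
  norm_map' w := by
    rw [← sq_eq_sq₀ (norm_nonneg _) (norm_nonneg _), WithLp.prod_norm_sq_eq_of_L2,
      WithLp.prod_norm_sq_eq_of_L2]
    change ‖z₁ • w.fst - (starRingEnd ℂ) z₂ • w.snd‖ ^ 2 +
      ‖z₂ • w.fst + (starRingEnd ℂ) z₁ • w.snd‖ ^ 2 = _
    rw [norm_sub_sq (𝕜 := ℂ), norm_add_sq (𝕜 := ℂ)]
    simp only [inner_smul_left, inner_smul_right, norm_smul, RCLike.norm_conj, mul_pow]
    -- The two cross terms carry the same factor `conj z₁ * conj z₂`, in opposite order and with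
    -- opposite signs; reordering one lets them cancel.
    rw [mul_left_comm]
    linear_combination (‖w.fst‖ ^ 2 + ‖w.snd‖ ^ 2) * hz

lemma rotation_apply {z₁ z₂ : ℂ} (hz : ‖z₁‖ ^ 2 + ‖z₂‖ ^ 2 = 1) (w : WithLp 2 (E × E)) :
    rotation E z₁ z₂ hz w = WithLp.toLp 2 (z₁ • w.fst - (starRingEnd ℂ) z₂ • w.snd,
      z₂ • w.fst + (starRingEnd ℂ) z₁ • w.snd) := rfl

lemma rotation_symm_apply {z₁ z₂ : ℂ} (hz : ‖z₁‖ ^ 2 + ‖z₂‖ ^ 2 = 1) (w : WithLp 2 (E × E)) :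
    (rotation E z₁ z₂ hz).symm w =
      WithLp.toLp 2 ((starRingEnd ℂ) z₁ • w.fst + (starRingEnd ℂ) z₂ • w.snd,
        z₁ • w.snd - z₂ • w.fst) := rfl

/-- The operator `1 ⊕ μ` of `ℂ ⊕ ℂ` for `|μ| = 1`. -/
def phase (μ : ℂ) (hμ : ‖μ‖ = 1) : WithLp 2 (ℂ × ℂ) ≃ₗᵢ[ℂ] WithLp 2 (ℂ × ℂ) where
  toFun w := WithLp.toLp 2 (w.fst, μ * w.snd)
  invFun w := WithLp.toLp 2 (w.fst, μ⁻¹ * w.snd)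
  map_add' v w := by
    exact (WithLp.ext_iff 2).2 (Prod.ext rfl (mul_add μ v.snd w.snd))
  map_smul' t w := by
    exact (WithLp.ext_iff 2).2 (Prod.ext rfl (mul_left_comm μ t w.snd))
  left_inv w := by
    have h : μ ≠ 0 := norm_ne_zero_iff.1 (by rw [hμ]; exact one_ne_zero)
    refine (WithLp.ext_iff 2).2 (Prod.ext rfl ?_)
    exact inv_mul_cancel_left₀ h _
  right_inv w := by
    have h : μ ≠ 0 := norm_ne_zero_iff.1 (by rw [hμ]; exact one_ne_zero)
    refine (WithLp.ext_iff 2).2 (Prod.ext rfl ?_)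
    exact mul_inv_cancel_left₀ h _
  norm_map' w := by
    rw [← sq_eq_sq₀ (norm_nonneg _) (norm_nonneg _), WithLp.prod_norm_sq_eq_of_L2,
      WithLp.prod_norm_sq_eq_of_L2]
    change ‖w.fst‖ ^ 2 + ‖μ * w.snd‖ ^ 2 = _
    rw [norm_mul, hμ, one_mul]

/-- A unitary operator of `E ⊕ E` preserving the first component is `1 ⊕ W` with `W` isometric. -/
lemma exists_isometry_of_fst_eq (T : WithLp 2 (E × E) ≃ₗᵢ[ℂ] WithLp 2 (E × E))
    (hT : ∀ w, (T w).fst = w.fst) :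
    ∃ W : E →ₗᵢ[ℂ] E, ∀ w, T w = WithLp.toLp 2 (w.fst, W w.snd) := by
  have hnorm : ∀ w, ‖(T w).snd‖ = ‖w.snd‖ := by
    intro w
    have h := congrArg (· ^ 2) (T.norm_map w)
    simp only [WithLp.prod_norm_sq_eq_of_L2, hT] at h
    rw [← sq_eq_sq₀ (norm_nonneg _) (norm_nonneg _)]
    linarith
  refine ⟨{ toFun := fun y => (T (WithLp.toLp 2 (0, y))).snd
            map_add' := fun x y => ?_
            map_smul' := fun t y => ?_
            norm_map' := fun y => hnorm _ }, fun w => ?_⟩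
  · rw [← WithLp.add_snd, ← map_add, ← WithLp.toLp_add, Prod.mk_add_mk, add_zero]
  · rw [RingHom.id_apply, ← WithLp.smul_snd, ← map_smul, ← WithLp.toLp_smul, Prod.smul_mk,
      smul_zero]
  · refine (WithLp.ext_iff 2).2 (Prod.ext (hT w) ?_)
    change (T w).snd = (T (WithLp.toLp 2 (0, w.snd))).snd
    -- This difference is `(w.fst, 0)`; as `T` keeps the norm of the second component, its image has
    -- second component zero.
    have h := hnorm (w - WithLp.toLp 2 (0, w.snd))
    rw [map_sub, WithLp.sub_snd, WithLp.sub_snd] at h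
    change _ = ‖w.snd - w.snd‖ at h
    rw [sub_self, norm_zero, norm_eq_zero, sub_eq_zero] at h
    exact h

end LinearAlgebra

/-! ### Weak derivatives, one-sided limits and attainable boundary values -/

section Analysis

variable {E F : Type*} [NormedAddCommGroup E] [InnerProductSpace ℂ E]
  [NormedAddCommGroup F] [InnerProductSpace ℂ F]

lemma IsWeakDeriv.compLpL [CompleteSpace E] [CompleteSpace F] {q : ℝ} {f g : L2 E}
    (h : IsWeakDeriv q f g) (L : E →L[ℂ] F) :
    IsWeakDeriv q (L.compLpL 2 volume f) (L.compLpL 2 volume g) := by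
  intro φ hφ hc hs
  have key : ∀ ψ : ℝ → ℝ, Continuous ψ → HasCompactSupport ψ → ∀ u : L2 E,
      ∫ x, ψ x • (L.compLpL 2 volume u : L2 F) x = L (∫ x, ψ x • u x) := by
    intro ψ hψ hψc u
    rw [← L.integral_comp_comm (integrable_smul u hψ hψc)]
    refine integral_congr_ae ?_
    filter_upwards [L.coeFn_compLpL (p := 2) (μ := (volume : Measure ℝ)) u] with x hx
    rw [hx, L.map_smul_of_tower]
  rw [key _ (hφ.continuous_deriv (by simp)) hc.deriv, key _ hφ.continuous hc, h φ hφ hc hs,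
    map_neg]

lemma HasOneSidedLimits.compLpL {q : ℝ} {f : L2 E} {a b : E}
    (h : HasOneSidedLimits q f a b) (L : E →L[ℂ] F) :
    HasOneSidedLimits q (L.compLpL 2 volume f : L2 F) (L a) (L b) := by
  have e := L.coeFn_compLpL (p := 2) (μ := (volume : Measure ℝ)) f
  exact ⟨((L.continuous.tendsto a).comp h.1).congr' (e.symm.filter_mono inf_le_right),
    ((L.continuous.tendsto b).comp h.2).congr' (e.symm.filter_mono inf_le_right)⟩

lemma IsWeakDeriv.sum {ι : Type*} (t : Finset ι) {q : ℝ} {f g : ι → L2 E}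
    (h : ∀ i, IsWeakDeriv q (f i) (g i)) : IsWeakDeriv q (∑ i ∈ t, f i) (∑ i ∈ t, g i) := by
  classical
  induction t using Finset.induction_on with
  | empty => simpa using IsWeakDeriv.zero q
  | insert i t hi ih => rw [Finset.sum_insert hi, Finset.sum_insert hi]; exact (h i).add ih

lemma HasOneSidedLimits.sum {ι : Type*} (t : Finset ι) {q : ℝ} {f : ι → L2 E} {a b : ι → E}
    (h : ∀ i, HasOneSidedLimits q (f i) (a i) (b i)) :
    HasOneSidedLimits q (∑ i ∈ t, f i) (∑ i ∈ t, a i) (∑ i ∈ t, b i) := by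
  classical
  induction t using Finset.induction_on with
  | empty => simpa using HasOneSidedLimits.zero q
  | insert i t hi ih =>
    rw [Finset.sum_insert hi, Finset.sum_insert hi, Finset.sum_insert hi]
    exact (h i).add ih

lemma memLp_glue {E : Type*} [NormedAddCommGroup E] {G H : ℝ → E} (q : ℝ) (hG : Continuous G) (hGc : HasCompactSupport G)
    (hH : Continuous H) (hHc : HasCompactSupport H) :
    MemLp ((Set.Iic q).indicator G + (Set.Ioi q).indicator H) 2 (volume : Measure ℝ) :=
  ((hG.memLp_of_hasCompactSupport hGc).indicator measurableSet_Iic).add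
    ((hH.memLp_of_hasCompactSupport hHc).indicator measurableSet_Ioi)

/-- The class in `L²(ℝ, E)` of the function equal to `G` on `(-∞, q]` and to `H` on `(q, ∞)`. -/
def glue {E : Type*} [NormedAddCommGroup E] {G H : ℝ → E} (q : ℝ) (hG : Continuous G) (hGc : HasCompactSupport G)
    (hH : Continuous H) (hHc : HasCompactSupport H) : L2 E :=
  (memLp_glue q hG hGc hH hHc).toLp _

lemma integral_smul_glue {G H : ℝ → E} (q : ℝ) (hG : Continuous G) (hGc : HasCompactSupport G)
    (hH : Continuous H) (hHc : HasCompactSupport H) {ψ : ℝ → ℝ} (hψ : Continuous ψ) :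
    ∫ x, ψ x • glue q hG hGc hH hHc x =
      (∫ x in Set.Iic q, ψ x • G x) + ∫ x in Set.Ioi q, ψ x • H x := by
  have i1 : Integrable (fun x => ψ x • G x) :=
    (hψ.smul hG).integrable_of_hasCompactSupport hGc.smul_left
  have i2 : Integrable (fun x => ψ x • H x) :=
    (hψ.smul hH).integrable_of_hasCompactSupport hHc.smul_left
  rw [← integral_indicator measurableSet_Iic, ← integral_indicator measurableSet_Ioi,
    ← integral_add (i1.indicator measurableSet_Iic) (i2.indicator measurableSet_Ioi)]
  refine integral_congr_ae ?_
  filter_upwards [(memLp_glue q hG hGc hH hHc).coeFn_toLp] with x hx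
  rw [glue, hx, Pi.add_apply, smul_add, Set.indicator_smul_apply, Set.indicator_smul_apply]

lemma hasOneSidedLimits_glue {E : Type*} [NormedAddCommGroup E] {G H : ℝ → E} (q : ℝ) (hG : Continuous G)
    (hGc : HasCompactSupport G) (hH : Continuous H) (hHc : HasCompactSupport H) :
    HasOneSidedLimits q (glue q hG hGc hH hHc) (G q) (H q) := by
  have e := (memLp_glue q hG hGc hH hHc).coeFn_toLp
  constructor
  · refine (((hG.tendsto q).mono_left nhdsWithin_le_nhds).mono_left inf_le_left).congr' ?_
    filter_upwards [e.filter_mono inf_le_right,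
      mem_inf_of_left (self_mem_nhdsWithin : Set.Iio q ∈ 𝓝[<] q)] with x hx hq
    have hq' : x < q := hq
    rw [glue, hx]
    simp [hq'.le, hq'.not_gt]
  · refine (((hH.tendsto q).mono_left nhdsWithin_le_nhds).mono_left inf_le_left).congr' ?_
    filter_upwards [e.filter_mono inf_le_right,
      mem_inf_of_left (self_mem_nhdsWithin : Set.Ioi q ∈ 𝓝[>] q)] with x hx hq
    have hq' : q < x := hq
    rw [glue, hx]
    simp [hq', hq'.not_ge]

/-- Integration by parts on each half-line: test functions vanish at `q`, so a jump from `G q` to `H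
q` leaves no boundary term. -/
lemma isWeakDeriv_glue [CompleteSpace E] {G H : ℝ → E} (q : ℝ) (hG : ContDiff ℝ 1 G)
    (hGc : HasCompactSupport G) (hH : ContDiff ℝ 1 H) (hHc : HasCompactSupport H) :
    IsWeakDeriv q (glue q hG.continuous hGc hH.continuous hHc)
      (glue q (hG.continuous_deriv le_rfl) hGc.deriv (hH.continuous_deriv le_rfl) hHc.deriv) := by
  intro φ hφ hc hs
  have hφq : φ q = 0 := by
    by_contra h0
    exact hs (subset_tsupport φ h0) rfl
  have hφ' : Continuous (deriv φ) := hφ.continuous_deriv (by simp)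
  have hφ1 : ContDiff ℝ 1 φ := hφ.of_le (by simp)
  have hderiv : ∀ K : ℝ → E, ContDiff ℝ 1 K →
      deriv (φ • K) = fun x => deriv φ x • K x + φ x • deriv K x := by
    intro K hK
    ext x
    rw [add_comm]
    exact (((hφ1.differentiable one_ne_zero x).hasDerivAt).smul
      ((hK.differentiable one_ne_zero x).hasDerivAt)).deriv
  have hintegrable : ∀ K : ℝ → E, ContDiff ℝ 1 K → Integrable (fun x => deriv φ x • K x) ∧
      Integrable (fun x => φ x • deriv K x) := fun K hK =>
    ⟨(hφ'.smul hK.continuous).integrable_of_hasCompactSupport hc.deriv.smul_right,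
      (hφ.continuous.smul (hK.continuous_deriv le_rfl)).integrable_of_hasCompactSupport
        hc.smul_right⟩
  rw [integral_smul_glue q _ _ _ _ hφ', integral_smul_glue q _ _ _ _ hφ.continuous]
  have h1 := HasCompactSupport.integral_Iic_deriv_eq (hφ1.smul hG) hc.smul_right q
  have h2 := HasCompactSupport.integral_Ioi_deriv_eq (hφ1.smul hH) hc.smul_right q
  rw [hderiv G hG, Pi.smul_apply', hφq, zero_smul,
    integral_add (hintegrable G hG).1.integrableOn (hintegrable G hG).2.integrableOn] at h1
  rw [hderiv H hH, Pi.smul_apply', hφq, zero_smul, neg_zero,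
    integral_add (hintegrable H hH).1.integrableOn (hintegrable H hH).2.integrableOn] at h2
  rw [eq_neg_of_add_eq_zero_left h1, eq_neg_of_add_eq_zero_left h2]
  abel

/-- A smooth compactly supported function with prescribed value and derivative at `q`. -/
lemma exists_contDiff_hasCompactSupport (q : ℝ) (a a' : E) :
    ∃ G : ℝ → E, ContDiff ℝ 2 G ∧ HasCompactSupport G ∧ G q = a ∧ deriv G q = a' := by
  -- The cutoff is 1 near `q`, so multiplying by it keeps the value and the derivative of the affine
  -- function at `q`.
  let χ : ContDiffBump q := ⟨1, 2, one_pos, one_lt_two⟩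
  refine ⟨fun x => χ x • (a + (x - q) • a'), ?_, χ.hasCompactSupport.smul_right, ?_, ?_⟩
  · have h : ContDiff ℝ 2 χ := χ.contDiff
    fun_prop
  · simp [χ.one_of_mem_closedBall (Metric.mem_closedBall_self χ.rIn_pos.le)]
  · have h : (fun x => χ x • (a + (x - q) • a')) =ᶠ[𝓝 q] fun x => a + (x - q) • a' := by
      filter_upwards [χ.eventuallyEq_one] with x hx
      rw [hx, Pi.one_apply, one_smul]
    rw [h.deriv_eq]
    have h1 : HasDerivAt (fun x : ℝ => a + (x - q) • a') ((1 : ℝ) • a') q :=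
      (((hasDerivAt_id q).sub_const q).smul_const a').const_add a
    rw [h1.deriv, one_smul]

/-- Arbitrary boundary values are attained by functions in `W^{2,2}(ℝ ∖ {q}, E)`. -/
lemma exists_boundary_values [CompleteSpace E] (q : ℝ) (a b a' b' : E) :
    ∃ f f' f'' : L2 E, IsWeakDeriv q f f' ∧ IsWeakDeriv q f' f'' ∧
      HasOneSidedLimits q f a b ∧ HasOneSidedLimits q f' a' b' := by
  obtain ⟨G, hG, hGc, rfl, rfl⟩ := exists_contDiff_hasCompactSupport q a a'
  obtain ⟨H, hH, hHc, rfl, rfl⟩ := exists_contDiff_hasCompactSupport q b b'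
  have hG1 : ContDiff ℝ 1 G := hG.of_le (by norm_num)
  have hH1 : ContDiff ℝ 1 H := hH.of_le (by norm_num)
  have hG' : ContDiff ℝ 1 (deriv G) := hG.deriv'
  have hH' : ContDiff ℝ 1 (deriv H) := hH.deriv'
  exact ⟨_, _, _, isWeakDeriv_glue q hG1 hGc hH1 hHc,
    isWeakDeriv_glue q hG' hGc.deriv hH' hHc.deriv,
    hasOneSidedLimits_glue q _ _ _ _, hasOneSidedLimits_glue q _ _ _ _⟩

end Analysis

/-! ### Decomposition into channels and reduction of `U` -/

section Reduction

variable {n : ℕ}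

/-- The functional `x ↦ (Θ x)_s` on `ℂⁿ`. -/
def channel (Θ : EuclideanSpace ℂ (Fin n) ≃ₗᵢ[ℂ] EuclideanSpace ℂ (Fin n)) (s : Fin n) :
    EuclideanSpace ℂ (Fin n) →L[ℂ] ℂ :=
  (EuclideanSpace.proj s : EuclideanSpace ℂ (Fin n) →L[ℂ] ℂ).comp
    (Θ.toContinuousLinearEquiv : EuclideanSpace ℂ (Fin n) →L[ℂ] EuclideanSpace ℂ (Fin n))

lemma channel_apply (Θ : EuclideanSpace ℂ (Fin n) ≃ₗᵢ[ℂ] EuclideanSpace ℂ (Fin n)) (s : Fin n)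
    (x : EuclideanSpace ℂ (Fin n)) : channel Θ s x = Θ x s := rfl

/-- The embedding `z ↦ z Θ⁻¹ e_s` of `ℂ` into `ℂⁿ`. -/
def inject (Θ : EuclideanSpace ℂ (Fin n) ≃ₗᵢ[ℂ] EuclideanSpace ℂ (Fin n)) (s : Fin n) :
    ℂ →L[ℂ] EuclideanSpace ℂ (Fin n) :=
  ContinuousLinearMap.toSpanSingleton ℂ (Θ.symm (EuclideanSpace.single s 1))

lemma map_sum_inject (Θ : EuclideanSpace ℂ (Fin n) ≃ₗᵢ[ℂ] EuclideanSpace ℂ (Fin n))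
    (z : Fin n → ℂ) : Θ (∑ s, inject Θ s (z s)) = WithLp.toLp 2 z := by
  ext t
  simp [inject, Pi.single_apply]

lemma channel_sum_inject (Θ : EuclideanSpace ℂ (Fin n) ≃ₗᵢ[ℂ] EuclideanSpace ℂ (Fin n))
    (z : Fin n → ℂ) (t : Fin n) : channel Θ t (∑ s, inject Θ s (z s)) = z t := by
  rw [channel_apply, map_sum_inject]

lemma sum_inject_channel (Θ : EuclideanSpace ℂ (Fin n) ≃ₗᵢ[ℂ] EuclideanSpace ℂ (Fin n))
    (x : EuclideanSpace ℂ (Fin n)) : ∑ s, inject Θ s (channel Θ s x) = x := by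
  refine Θ.injective ?_
  rw [map_sum_inject]
  rfl

lemma component_pointwise (Θ : EuclideanSpace ℂ (Fin n) ≃ₗᵢ[ℂ] EuclideanSpace ℂ (Fin n))
    (s : Fin n) (f : L2 (EuclideanSpace ℂ (Fin n))) :
    component s (pointwise Θ f) = (channel Θ s).compLpL 2 volume f := by
  refine Lp.ext ?_
  filter_upwards [
    (EuclideanSpace.proj s : EuclideanSpace ℂ (Fin n) →L[ℂ] ℂ).coeFn_compLpL (p := 2)
      (μ := (volume : Measure ℝ)) (pointwise Θ f),
    (Θ.toContinuousLinearEquiv : EuclideanSpace ℂ (Fin n) →L[ℂ]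
      EuclideanSpace ℂ (Fin n)).coeFn_compLpL (p := 2) (μ := (volume : Measure ℝ)) f,
    (channel Θ s).coeFn_compLpL (p := 2) (μ := (volume : Measure ℝ)) f] with x h1 h2 h3
  rw [h3]
  refine h1.trans ?_
  change EuclideanSpace.proj s (pointwise Θ f x) = _
  rw [show pointwise Θ f x = Θ (f x) from h2]
  rfl

/-- The resolution of the identity in the basis `Θ⁻¹ e_s`, lifted to `L²`; it reassembles a function
from its channels. -/
lemma sum_inject_compLpL_channel
    (Θ : EuclideanSpace ℂ (Fin n) ≃ₗᵢ[ℂ] EuclideanSpace ℂ (Fin n))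
    (f : L2 (EuclideanSpace ℂ (Fin n))) :
    ∑ s, (inject Θ s).compLpL 2 volume ((channel Θ s).compLpL 2 volume f) = f := by
  refine Lp.ext ?_
  have h1 : ∀ᵐ x ∂(volume : Measure ℝ), ∀ s, (inject Θ s).compLpL 2 volume
      ((channel Θ s).compLpL 2 volume f) x = inject Θ s (channel Θ s (f x)) := by
    refine ae_all_iff.2 fun s => ?_
    filter_upwards [(inject Θ s).coeFn_compLpL (p := 2) (μ := (volume : Measure ℝ))
      ((channel Θ s).compLpL 2 volume f),
      (channel Θ s).coeFn_compLpL (p := 2) (μ := (volume : Measure ℝ)) f] with x h1 h2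
    rw [h1, h2]
  filter_upwards [h1, Lp.coeFn_finsetSum Finset.univ
    (fun s => (inject Θ s).compLpL 2 volume ((channel Θ s).compLpL 2 volume f))] with x h1 h2
  rw [h2, Finset.sum_apply, Finset.sum_congr rfl fun s _ => h1 s, sum_inject_channel]

/-- The `s`-th channel of a vector of `ℂⁿ ⊕ ℂⁿ`. -/
def channelPair (Θ : EuclideanSpace ℂ (Fin n) ≃ₗᵢ[ℂ] EuclideanSpace ℂ (Fin n)) (s : Fin n)
    (w : WithLp 2 (EuclideanSpace ℂ (Fin n) × EuclideanSpace ℂ (Fin n))) : WithLp 2 (ℂ × ℂ) :=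
  WithLp.toLp 2 (channel Θ s w.fst, channel Θ s w.snd)

lemma channelPair_ext (Θ : EuclideanSpace ℂ (Fin n) ≃ₗᵢ[ℂ] EuclideanSpace ℂ (Fin n))
    {v w : WithLp 2 (EuclideanSpace ℂ (Fin n) × EuclideanSpace ℂ (Fin n))}
    (h : ∀ s, channelPair Θ s v = channelPair Θ s w) : v = w := by
  refine (WithLp.ext_iff 2).2 (Prod.ext (Θ.injective ?_) (Θ.injective ?_)) <;> ext s
  · exact congrArg WithLp.fst (h s)
  · exact congrArg WithLp.snd (h s)

/-- A rotation combines the two ends with scalar coefficients, so it commutes with the linear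
functional that selects a channel. -/
lemma channelPair_rotation (Θ : EuclideanSpace ℂ (Fin n) ≃ₗᵢ[ℂ] EuclideanSpace ℂ (Fin n))
    (s : Fin n) {z₁ z₂ : ℂ} (hz : ‖z₁‖ ^ 2 + ‖z₂‖ ^ 2 = 1)
    (w : WithLp 2 (EuclideanSpace ℂ (Fin n) × EuclideanSpace ℂ (Fin n))) :
    channelPair Θ s (rotation _ z₁ z₂ hz w) = rotation ℂ z₁ z₂ hz (channelPair Θ s w) := by
  simp [channelPair, rotation_apply]

/-- If `U` acts on the `s`-th channel as `V s`, its boundary condition is the conjunction of the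
boundary conditions of the `V s`. -/
lemma boundaryCondition_iff
    {U : WithLp 2 (EuclideanSpace ℂ (Fin n) × EuclideanSpace ℂ (Fin n)) ≃ₗᵢ[ℂ]
      WithLp 2 (EuclideanSpace ℂ (Fin n) × EuclideanSpace ℂ (Fin n))}
    {Θ : EuclideanSpace ℂ (Fin n) ≃ₗᵢ[ℂ] EuclideanSpace ℂ (Fin n)}
    {V : Fin n → (WithLp 2 (ℂ × ℂ) ≃ₗᵢ[ℂ] WithLp 2 (ℂ × ℂ))}
    (hUV : ∀ s w, channelPair Θ s (U w) = V s (channelPair Θ s w))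
    (a b a' b' : EuclideanSpace ℂ (Fin n)) :
    BoundaryCondition U a b a' b' ↔ ∀ s, BoundaryCondition (V s)
      (channel Θ s a) (channel Θ s b) (channel Θ s a') (channel Θ s b') := by
  have e1 : ∀ s, channelPair Θ s (Gamma1 a b - Complex.I • Gamma2 a' b') =
      Gamma1 (channel Θ s a) (channel Θ s b) -
        Complex.I • Gamma2 (channel Θ s a') (channel Θ s b') := fun s => by
    simp [channelPair, Gamma1, Gamma2, WithLp.ext_iff]
  have e2 : ∀ s, channelPair Θ s (Gamma1 a b + Complex.I • Gamma2 a' b') =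
      Gamma1 (channel Θ s a) (channel Θ s b) +
        Complex.I • Gamma2 (channel Θ s a') (channel Θ s b') := fun s => by
    simp [channelPair, Gamma1, Gamma2, WithLp.ext_iff]
  constructor
  · intro h s
    have := congrArg (channelPair Θ s) h
    rwa [hUV, e1, e2] at this
  · intro h
    refine channelPair_ext Θ fun s => ?_
    rw [hUV, e1, e2]
    exact h s

/-- Weak derivatives and one-sided limits pass through bounded linear maps, so they can be taken
channel by channel and reassembled by summing the embeddings; `boundaryCondition_iff` treats the
condition at `q`. -/
lemma isReducible_of_channelPair (q : ℝ)
    {U : WithLp 2 (EuclideanSpace ℂ (Fin n) × EuclideanSpace ℂ (Fin n)) ≃ₗᵢ[ℂ]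
      WithLp 2 (EuclideanSpace ℂ (Fin n) × EuclideanSpace ℂ (Fin n))}
    (Θ : EuclideanSpace ℂ (Fin n) ≃ₗᵢ[ℂ] EuclideanSpace ℂ (Fin n))
    (V : Fin n → (WithLp 2 (ℂ × ℂ) ≃ₗᵢ[ℂ] WithLp 2 (ℂ × ℂ)))
    (hUV : ∀ s w, channelPair Θ s (U w) = V s (channelPair Θ s w)) :
    IsReducible q (hamiltonian q U) := by
  refine ⟨Θ, V, fun f h => ?_⟩
  have hgraph : (pointwise Θ f, pointwise Θ h) ∈ directSumGraph (fun s => hamiltonian q (V s)) ↔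
      ∀ s, ((channel Θ s).compLpL 2 volume f, (channel Θ s).compLpL 2 volume h) ∈
        hamiltonianGraph q (V s) := by
    refine forall_congr' fun s => ?_
    rw [component_pointwise, component_pointwise, hamiltonian_graph]
  rw [hamiltonian_graph, directSum_graph, hgraph]
  constructor
  · rintro ⟨f', f'', h1, h2, h3, a, b, a', b', h4, h5, h6⟩ s
    change h = _ at h3
    exact ⟨_, _, h1.compLpL (channel Θ s), h2.compLpL (channel Θ s), by rw [h3, map_neg],
      _, _, _, _, h4.compLpL (channel Θ s), h5.compLpL (channel Θ s),
      (boundaryCondition_iff hUV a b a' b').1 h6 s⟩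
  · intro H
    choose f' f'' h1 h2 h3 a b a' b' h4 h5 h6 using H
    refine ⟨∑ s, (inject Θ s).compLpL 2 volume (f' s), ∑ s, (inject Θ s).compLpL 2 volume (f'' s),
      ?_, IsWeakDeriv.sum _ fun s => (h2 s).compLpL (inject Θ s), ?_,
      ∑ s, inject Θ s (a s), ∑ s, inject Θ s (b s), ∑ s, inject Θ s (a' s), ∑ s, inject Θ s (b' s),
      ?_, HasOneSidedLimits.sum _ fun s => (h5 s).compLpL (inject Θ s), ?_⟩
    · have := IsWeakDeriv.sum Finset.univ fun s => (h1 s).compLpL (inject Θ s)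
      rwa [sum_inject_compLpL_channel] at this
    · change h = _
      rw [← sum_inject_compLpL_channel Θ h, ← Finset.sum_neg_distrib]
      refine Finset.sum_congr rfl fun s _ => ?_
      rw [← map_neg]
      exact congrArg _ (h3 s)
    · have := HasOneSidedLimits.sum Finset.univ fun s => (h4 s).compLpL (inject Θ s)
      rwa [sum_inject_compLpL_channel] at this
    · refine (boundaryCondition_iff hUV _ _ _ _).2 fun s => ?_
      simp only [channel_sum_inject]
      exact h6 s

/-- A unitary `U` that becomes `1 ⊕ W` after rotations acting only on the two ends is diagonal in
channels adapted to `W`. -/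
lemma isReducible_of_rotation (q : ℝ)
    (U : WithLp 2 (EuclideanSpace ℂ (Fin n) × EuclideanSpace ℂ (Fin n)) ≃ₗᵢ[ℂ]
      WithLp 2 (EuclideanSpace ℂ (Fin n) × EuclideanSpace ℂ (Fin n)))
    {z₁ z₂ w₁ w₂ : ℂ} (hz : ‖z₁‖ ^ 2 + ‖z₂‖ ^ 2 = 1) (hw : ‖w₁‖ ^ 2 + ‖w₂‖ ^ 2 = 1)
    (h : ∀ v, ((rotation _ w₁ w₂ hw).symm (U v)).fst = ((rotation _ z₁ z₂ hz).symm v).fst) :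
    IsReducible q (hamiltonian q U) := by
  obtain ⟨W, hW⟩ := exists_isometry_of_fst_eq
    (((rotation _ z₁ z₂ hz).trans U).trans (rotation _ w₁ w₂ hw).symm) (fun v => by
      have := h (rotation _ z₁ z₂ hz v)
      rwa [LinearIsometryEquiv.symm_apply_apply] at this)
  obtain ⟨b, μ, hb⟩ := exists_orthonormalBasis_of_isometry finrank_euclideanSpace_fin W
  have hμ : ∀ s, ‖μ s‖ = 1 := fun s => by
    have h1 := W.norm_map (b s)
    rw [hb, norm_smul, b.norm_eq_one, mul_one] at h1
    exact h1
  have hdiag : ∀ s x, channel b.repr s (W x) = μ s * channel b.repr s x := by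
    intro s x
    conv_lhs => rw [← b.sum_repr x]
    simp only [map_sum, map_smul, hb, channel_apply]
    simp [mul_comm]
  -- In the channel of the eigenvector `b s` the factor `1 ⊕ W` acts as `1 ⊕ μ s`; undoing the two
  -- rotations gives `V s`.
  refine isReducible_of_channelPair q b.repr (fun s =>
    ((rotation ℂ z₁ z₂ hz).symm.trans (phase (μ s) (hμ s))).trans (rotation ℂ w₁ w₂ hw)) ?_
  intro s v
  have hU : U v = rotation _ w₁ w₂ hw (WithLp.toLp 2 (((rotation _ z₁ z₂ hz).symm v).fst,
      W ((rotation _ z₁ z₂ hz).symm v).snd)) := by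
    rw [← hW]
    simp
  obtain ⟨u, rfl⟩ := (rotation _ z₁ z₂ hz).surjective v
  rw [hU]
  simp only [LinearIsometryEquiv.trans_apply, channelPair_rotation,
    LinearIsometryEquiv.symm_apply_apply]
  refine congrArg _ ((WithLp.ext_iff 2).2 (Prod.ext rfl ?_))
  exact hdiag s u.snd

/-- The linear relation on boundary values in terms of `U`. -/
lemma boundary_relation {q : ℝ}
    {U : WithLp 2 (EuclideanSpace ℂ (Fin n) × EuclideanSpace ℂ (Fin n)) ≃ₗᵢ[ℂ]
      WithLp 2 (EuclideanSpace ℂ (Fin n) × EuclideanSpace ℂ (Fin n))}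
    {α β c c' : ℂ}
    (hdom : ∀ f ∈ (hamiltonian q U).domain, ∀ fm fp dfm dfp : EuclideanSpace ℂ (Fin n),
        HasBoundaryValues q f fm fp dfm dfp → α • (dfp + c' • dfm) = β • (fp + c • fm))
    (w : WithLp 2 (EuclideanSpace ℂ (Fin n) × EuclideanSpace ℂ (Fin n))) :
    (-(Complex.I * α * c') - β * c) • (U w).fst + (Complex.I * α - β) • (U w).snd =
      (-(Complex.I * α * c') + β * c) • w.fst + (Complex.I * α + β) • w.snd := by
  have hI : Complex.I * Complex.I = -1 := Complex.I_mul_I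
  -- These values solve `Γ₁ + iΓ₂ = w` and `Γ₁ - iΓ₂ = U w`; the two derivatives differ in sign
  -- because `Γ₂` contains `-f'(q-)`.
  have hBC : BoundaryCondition U ((1 / 2 : ℂ) • (w.fst + (U w).fst))
      ((1 / 2 : ℂ) • (w.snd + (U w).snd)) ((Complex.I / 2) • (w.fst - (U w).fst))
      (-(Complex.I / 2) • (w.snd - (U w).snd)) := by
    have e : Gamma1 ((1 / 2 : ℂ) • (w.fst + (U w).fst)) ((1 / 2 : ℂ) • (w.snd + (U w).snd)) +
        Complex.I • Gamma2 ((Complex.I / 2) • (w.fst - (U w).fst))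
          (-(Complex.I / 2) • (w.snd - (U w).snd)) = w := by
      refine (WithLp.ext_iff 2).2 (Prod.ext ?_ ?_)
      · change (1 / 2 : ℂ) • (w.fst + (U w).fst) +
          Complex.I • (-((Complex.I / 2) • (w.fst - (U w).fst))) = w.fst
        match_scalars
        · linear_combination (-1 / 2 : ℂ) * hI
        · linear_combination (1 / 2 : ℂ) * hI
      · change (1 / 2 : ℂ) • (w.snd + (U w).snd) +
          Complex.I • (-(Complex.I / 2) • (w.snd - (U w).snd)) = w.snd
        match_scalars
        · linear_combination (-1 / 2 : ℂ) * hI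
        · linear_combination (1 / 2 : ℂ) * hI
    unfold BoundaryCondition
    rw [e]
    refine (WithLp.ext_iff 2).2 (Prod.ext ?_ ?_)
    · change (1 / 2 : ℂ) • (w.fst + (U w).fst) -
        Complex.I • (-((Complex.I / 2) • (w.fst - (U w).fst))) = (U w).fst
      match_scalars
      · linear_combination (1 / 2 : ℂ) * hI
      · linear_combination (-1 / 2 : ℂ) * hI
    · change (1 / 2 : ℂ) • (w.snd + (U w).snd) -
        Complex.I • (-(Complex.I / 2) • (w.snd - (U w).snd)) = (U w).snd
      match_scalars
      · linear_combination (1 / 2 : ℂ) * hI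
      · linear_combination (-1 / 2 : ℂ) * hI
  obtain ⟨f, f', f'', h1, h2, h3, h4⟩ := exists_boundary_values q
    ((1 / 2 : ℂ) • (w.fst + (U w).fst)) ((1 / 2 : ℂ) • (w.snd + (U w).snd))
    ((Complex.I / 2) • (w.fst - (U w).fst)) (-(Complex.I / 2) • (w.snd - (U w).snd))
  have hmem : f ∈ (hamiltonian q U).domain := by
    have hg : (f, -f'') ∈ (hamiltonian q U).graph := by
      rw [hamiltonian_graph]
      exact ⟨f', f'', h1, h2, rfl, _, _, _, _, h3, h4, hBC⟩
    exact LinearPMap.mem_domain_of_mem_graph hg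
  have h := hdom f hmem _ _ _ _ ⟨h3, f', h1, h4⟩
  -- The factor 2 clears the halves in the boundary values.
  linear_combination (norm := module) (2 : ℂ) • h

end Reduction

end CoupledChannels

end

/-! ### Choice of the two rotations -/

theorem mainTheorem5 (n : ℕ) (q : ℝ)
    (U : WithLp 2 (EuclideanSpace ℂ (Fin n) × EuclideanSpace ℂ (Fin n)) ≃ₗᵢ[ℂ]
      WithLp 2 (EuclideanSpace ℂ (Fin n) × EuclideanSpace ℂ (Fin n)))
    (α β c c' : ℝ) (hαβ : α ≠ 0 ∨ β ≠ 0) (hc : c = 1 ∨ c = -1) (hc' : c' = 1 ∨ c' = -1)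
    (hdom : ∀ f ∈ (CoupledChannels.hamiltonian q U).domain,
      ∀ fm fp dfm dfp : EuclideanSpace ℂ (Fin n),
        CoupledChannels.HasBoundaryValues q f fm fp dfm dfp →
          (α : ℂ) • (dfp + (c' : ℂ) • dfm) = (β : ℂ) • (fp + (c : ℂ) • fm)) :
    CoupledChannels.IsReducible q (CoupledChannels.hamiltonian q U) := by
  have hrel := CoupledChannels.boundary_relation hdom
  have hpos : 0 < 2 * (α ^ 2 + β ^ 2) := by
    rcases hαβ with h | h <;> positivity
  -- The common norm of the two coefficient rows in `boundary_relation`.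
  set N : ℝ := √(2 * (α ^ 2 + β ^ 2))
  have hN2 : N ^ 2 = 2 * (α ^ 2 + β ^ 2) := Real.sq_sqrt hpos.le
  have hN0 : N ≠ 0 := (Real.sqrt_pos.2 hpos).ne'
  have hc2 : c ^ 2 = 1 := by rcases hc with rfl | rfl <;> norm_num
  have hc2' : c' ^ 2 = 1 := by rcases hc' with rfl | rfl <;> norm_num
  have hnorm : ∀ x y : ℝ, ‖((x : ℂ) + y * Complex.I) / N‖ ^ 2 = (x ^ 2 + y ^ 2) / N ^ 2 := by
    intro x y
    rw [norm_div, div_pow, ← Complex.normSq_eq_norm_sq, Complex.normSq_add_mul_I,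
      Complex.norm_real, Real.norm_eq_abs, sq_abs]
  have hconj : ∀ x y : ℝ, (starRingEnd ℂ) (((x : ℂ) + y * Complex.I) / N) =
      (N : ℂ)⁻¹ * (x - y * Complex.I) := by
    intro x y
    simp only [map_div₀, map_add, map_mul, Complex.conj_ofReal, Complex.conj_I]
    ring
  -- The inverse rotation has first row `(conj z₁, conj z₂)`, so these are the conjugated
  -- coefficients of `boundary_relation` divided by `N`: `z₁, z₂` from the side of `v` and `w₁, w₂`
  -- from the side of `U v`.
  refine CoupledChannels.isReducible_of_rotation q U
    (z₁ := (((β * c : ℝ) : ℂ) + ((α * c' : ℝ) : ℂ) * Complex.I) / N)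
    (z₂ := ((β : ℂ) + ((-α : ℝ) : ℂ) * Complex.I) / N)
    (w₁ := (((-(β * c) : ℝ) : ℂ) + ((α * c' : ℝ) : ℂ) * Complex.I) / N)
    (w₂ := (((-β : ℝ) : ℂ) + ((-α : ℝ) : ℂ) * Complex.I) / N) ?_ ?_ ?_
  · rw [hnorm, hnorm, ← add_div, div_eq_one_iff_eq (pow_ne_zero 2 hN0), hN2]
    linear_combination β ^ 2 * hc2 + α ^ 2 * hc2'
  · rw [hnorm, hnorm, ← add_div, div_eq_one_iff_eq (pow_ne_zero 2 hN0), hN2]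
    linear_combination β ^ 2 * hc2 + α ^ 2 * hc2'
  · intro v
    rw [CoupledChannels.rotation_symm_apply, CoupledChannels.rotation_symm_apply]
    change _ • _ + _ • _ = _ • _ + _ • _
    rw [hconj, hconj, hconj, hconj]
    simp only [mul_smul _ _ (_ : EuclideanSpace ℂ (Fin n)), ← smul_add]
    -- This removes the common factor `N⁻¹`, leaving the relation `hrel v`.
    congr 1
    have h := hrel v
    push_cast
    linear_combination (norm := module) h
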